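/- Let $N\ge 1$, let $A\in\mathbb R^{n\times n}$, $B\in\mathbb R^{n\times m}$, $C\in\mathbb R^{p\times n}$, and write $\Sigma=(A,B,C)$. Let $\mathrm{He}\{X\}=X^T+X$; $X\succ 0$ ($X\prec 0$) means symmetric positive (negative) definite; $\otimes$ is the Kronecker product; $\mathbf e_{(k,i)}$ is the $i$-th unit vector of $\mathbb R^k$; $\mathcal L_k=[\,\mathbf I_k\ \mathbf 0_k\,]$ and $\mathcal R_k=[\,\mathbf 0_k\ \mathbf I_k\,]$ in $\mathbb R^{k\times(k+1)}$; $\mathbf T_N$ is the $N\times N$ matrix with ones on the antidiagonal and zeros elsewhere. For symmetric $P\in\mathbb R^{n\times n}$ put $$\mathcal X_N(P)=\big(-\mathbf e_{(N+1,1)}\mathbf e_{(N+1,1)}^T+\mathbf e_{(N+1,N+1)}\mathbf e_{(N+1,N+1)}^T\big)\otimes P,\qquad \Pi_N=\begin{bmatrix}\mathbf e_{(N,1)}^T\otimes \mathbf I_n&\mathbf 0\\ \mathbf I_N\otimes A&\mathbf I_N\otimes B\end{bmatrix}.$$ An output-feedback gain matrix is a block lower triangular matrix $\mathcal F\in\mathbb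 R^{Nm\times Np}$ with $m\times p$ blocks: its block in row $i$ and column $j$ ($0\le j\le i\le N-1$) is an arbitrary matrix $F^{(i,\,i-j)}$, and its other blocks are zero. It represents the controller $u(k)=\sum_{i=0}^{k \bmod N}F^{(k\bmod N,\,i)}y(k-i)$ for $x(k+1)=Ax(k)+Bu(k)$, $y(k)=Cx(k)$. For $1\le\delta\le N$ let $\mathcal F^{(\delta)}$ be its leading $\delta\times\delta$ block part, let $\Phi_0=\mathbf I_n$, and define recursively $$\mathcal A_\delta=[\,\mathbf 0\ \ \mathbf I_n\,]\big(\mathbf I_\delta\otimes A+(\mathbf I_\delta\otimes B)\mathcal F^{(\delta)}(\mathbf I_\delta\otimes C)\big)\Phi_{\delta-1},\qquad \Phi_\delta=\begin{bmatrix}\Phi_{\delta-1}\\ \mathcal A_\delta\end{bmatrix},\qquad \mathcal A_{\rm LTI}(\mathcal F,\Sigma)=\mathcal A_N,$$ so that $x(N(t+1))=\mathcal A_{\rm LTI}(\mathcal F,\Sigma)\,x(Nt)$ in closed loop. For a state-feedback gain $\mathcal F\in\mathbb R^{Nm\times Nn}$, $\mathcal A_{\rm LTI}(\mathcal F,\Sigma)$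 is defined in the same way with $p=n$ and $C$ replaced by $\mathbf I_n$. For a square matrix $S\in\mathbb R^{n\times n}$ let $\mathcal P(S)=\{P\succ 0: S^TPS-P\prec 0\}$, and let $\mathcal S^{(N)}_{\rm SOF}(\Sigma)$ be the union of $\mathcal P(\mathcal A_{\rm LTI}(\mathcal F,\Sigma))$ over all output-feedback gain matrices $\mathcal F$ for which $\mathcal A_{\rm LTI}(\mathcal F,\Sigma)$ has spectral radius less than $1$. Suppose that $\hat P=\hat P^T\in\mathbb R^{n\times n}$ and the block upper triangular matrices $\hat{\mathcal J}\in\mathbb R^{Nm\times Nn}$ ($m\times n$ blocks) and $\hat{\mathcal G}\in\mathbb R^{Nn\times Nn}$ ($n\times n$ blocks) satisfy Ebihara's LMI $$\mathcal X_N(\hat P)+\mathrm{He}\big\{(\mathcal L_N^T\otimes A)\hat{\mathcal G}(\mathcal R_N\otimes \mathbf I_n)+(\mathcal L_N^T\otimes B)\hat{\mathcal J}(\mathcal R_N\otimes \mathbf I_n)-(\mathcal R_N^T\otimes \mathbf I_n)\hat{\mathcal G}(\mathcal R_N\otimes \mathbf I_n)\big\}\prec 0$$ (which forces $\hat{\mathcal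 G}$ to be invertible), and let $\hat{\mathcal F}_{\rm SF}=(\mathbf T_N\otimes \mathbf I_m)\hat{\mathcal J}\hat{\mathcal G}^{-1}(\mathbf T_N\otimes \mathbf I_n)$. Put $$\mathcal H(\hat{\mathcal F}_{\rm SF})=\begin{bmatrix}\hat{\mathcal F}_{\rm SF}&-\mathbf I_{Nm}\\ \mathcal L_{N-1}\otimes A-\mathcal R_{N-1}\otimes \mathbf I_n&\mathcal L_{N-1}\otimes B\end{bmatrix},\qquad \mathcal C(\mathcal F)=\begin{bmatrix}\mathcal F(\mathbf I_N\otimes C)&-\mathbf I_{Nm}\\ \mathcal L_{N-1}\otimes A-\mathcal R_{N-1}\otimes \mathbf I_n&\mathcal L_{N-1}\otimes B\end{bmatrix}.$$ Then there exist a symmetric $P\in\mathbb R^{n\times n}$, a matrix $\mathcal V\in\mathbb R^{((N-1)n+Nm)\times((N-1)n+Nm)}$ and an output-feedback gain matrix $\mathcal F_{\rm SOF}\in\mathbb R^{Nm\times Np}$ such that $$P\succ 0,\qquad \Pi_N^T\mathcal X_N(P)\Pi_N+\mathrm{He}\{\mathcal H(\hat{\mathcal F}_{\rm SF})^T\,\mathcal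 V\,\mathcal C(\mathcal F_{\rm SOF})\}\prec 0$$ if and only if $$\mathcal P\big(\mathcal A_{\rm LTI}(\hat{\mathcal F}_{\rm SF},\Sigma)\big)\cap\mathcal S^{(N)}_{\rm SOF}(\Sigma)\neq\emptyset .$$ -/

import Mathlib

open scoped Matrix Kronecker

namespace PTVM

noncomputable section

/-! ### Notation for matrices -/

/-- `He{A} = Aᵀ + A`. -/
def He {ι : Type*} (A : Matrix ι ι ℝ) : Matrix ι ι ℝ := Aᵀ + A

/-- `A ≺ 0`: the real matrix `A` is symmetric and negative definite. -/
def NegDef {ι : Type*} (A : Matrix ι ι ℝ) : Prop := (-A).PosDef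

/-- The `k × l` matrix with ones at the positions `(i, i)` and zeros elsewhere.  The matrix
`ℒ_N = [I_N 0_N]` is `leftSel N (N + 1)`, and `ℒ_{N-1}` is `leftSel (N - 1) N`. -/
def leftSel (k l : ℕ) : Matrix (Fin k) (Fin l) ℝ :=
  Matrix.of fun i j => if (j : ℕ) = (i : ℕ) then 1 else 0

/-- The `k × l` matrix with ones at the positions `(i, i + 1)` and zeros elsewhere.  The matrix
`ℛ_N = [0_N I_N]` is `rightSel N (N + 1)`, and `ℛ_{N-1}` is `rightSel (N - 1) N`. -/
def rightSel (k l : ℕ) : Matrix (Fin k) (Fin l) ℝ :=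
  Matrix.of fun i j => if (j : ℕ) = (i : ℕ) + 1 then 1 else 0

/-- The unit vector `e_{(N, i)}` of dimension `N`; the components are counted from `1`. -/
def unitVec (N i : ℕ) : Fin N → ℝ := fun j => if (j : ℕ) + 1 = i then 1 else 0

/-- The `N × N` matrix `T_N` with ones on the antidiagonal. -/
def flip (N : ℕ) : Matrix (Fin N) (Fin N) ℝ :=
  Matrix.of fun i j => if (i : ℕ) + (j : ℕ) + 1 = N then 1 else 0

/-- An `N × N` block matrix with blocks of size `a × b` that is block upper triangular. -/
def IsBlockUpper {N a b : ℕ} (G : Matrix (Fin N × Fin a) (Fin N × Fin b) ℝ) : Prop :=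
  ∀ i j : Fin N, j < i → ∀ (r : Fin a) (c : Fin b), G (i, r) (j, c) = 0

/-! ### Memory feedback gains and the lifted time-invariant system -/

/-- The gain matrix `𝓕^{(N,↓)}` assembled from the gains `F^{(i,j)}` of the periodic memory
controller `u(k) = ∑_{i=0}^{k mod N} F^{(k mod N, i)} y(k - i)`: the block in row `i` and column
`j` is `F^{(i, i-j)}` for `j ≤ i` and zero for `j > i`. -/
def gainDown {N m p : ℕ} (F : Fin N → Fin N → Matrix (Fin m) (Fin p) ℝ) :
    Matrix (Fin N × Fin m) (Fin N × Fin p) ℝ :=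
  Matrix.of fun r c =>
    if r.1 < c.1 then 0
    else F r.1 ⟨(r.1 : ℕ) - (c.1 : ℕ), lt_of_le_of_lt (Nat.sub_le _ _) r.1.isLt⟩ r.2 c.2

/-- The leading part `𝓕^{(δ,↓)}` of `𝓕^{(N,↓)}`, made of the first `δ` block rows and columns. -/
def truncGain {N m p : ℕ} (F : Matrix (Fin N × Fin m) (Fin N × Fin p) ℝ) (δ : ℕ) (h : δ ≤ N) :
    Matrix (Fin δ × Fin m) (Fin δ × Fin p) ℝ :=
  F.submatrix (fun r => (Fin.castLE h r.1, r.2)) (fun c => (Fin.castLE h c.1, c.2))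

/-- `𝒜_AUG^{(δ,↓)} = I_δ ⊗ A + (I_δ ⊗ B) 𝓕^{(δ,↓)} (I_δ ⊗ C)`. -/
def augMatrix {N n m p : ℕ} (A : Matrix (Fin n) (Fin n) ℝ) (B : Matrix (Fin n) (Fin m) ℝ)
    (C : Matrix (Fin p) (Fin n) ℝ) (F : Matrix (Fin N × Fin m) (Fin N × Fin p) ℝ)
    (δ : ℕ) (h : δ ≤ N) : Matrix (Fin δ × Fin n) (Fin δ × Fin n) ℝ :=
  (1 : Matrix (Fin δ) (Fin δ) ℝ) ⊗ₖ A
    + ((1 : Matrix (Fin δ) (Fin δ) ℝ) ⊗ₖ B) * truncGain F δ h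
      * ((1 : Matrix (Fin δ) (Fin δ) ℝ) ⊗ₖ C)

/-- The block column `[I_n; 𝒜_LTI(𝓕^{(1,↓)}); …; 𝒜_LTI(𝓕^{(δ,↓)})]`, built recursively: the block
`𝒜_LTI(𝓕^{(δ+1,↓)})` is the last block row of `𝒜_AUG^{(δ+1,↓)}` times the column built before. -/
def stackLTI {N n m p : ℕ} (A : Matrix (Fin n) (Fin n) ℝ) (B : Matrix (Fin n) (Fin m) ℝ)
    (C : Matrix (Fin p) (Fin n) ℝ) (F : Matrix (Fin N × Fin m) (Fin N × Fin p) ℝ) :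
    (δ : ℕ) → δ ≤ N → Matrix (Fin (δ + 1) × Fin n) (Fin n) ℝ
  | 0, _ => Matrix.of fun r c => (1 : Matrix (Fin n) (Fin n) ℝ) r.2 c
  | δ + 1, h => Matrix.of fun r c =>
      Fin.lastCases (motive := fun _ => ℝ)
        ((augMatrix A B C F (δ + 1) h * stackLTI A B C F δ (Nat.le_of_succ_le h))
          (Fin.last δ, r.2) c)
        (fun i => stackLTI A B C F δ (Nat.le_of_succ_le h) (i, r.2) c) r.1

/-- `𝒜_LTI(𝓕^{(N,↓)}, Σ)`, the transition matrix from `x(Nt)` to `x(N(t+1))` of the closed loop of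
`Σ = (A, B, C)` with the memory output feedback gain `𝓕^{(N,↓)}`. -/
def aLTI {N n m p : ℕ} (A : Matrix (Fin n) (Fin n) ℝ) (B : Matrix (Fin n) (Fin m) ℝ)
    (C : Matrix (Fin p) (Fin n) ℝ) (F : Matrix (Fin N × Fin m) (Fin N × Fin p) ℝ) :
    Matrix (Fin n) (Fin n) ℝ :=
  Matrix.of fun a b => stackLTI A B C F N le_rfl (Fin.last N, a) b

/-- `𝒜_LTI` for a memory state-feedback gain, that is, for `y = x`. -/
def aLTIState {N n m : ℕ} (A : Matrix (Fin n) (Fin n) ℝ) (B : Matrix (Fin n) (Fin m) ℝ)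
    (F : Matrix (Fin N × Fin m) (Fin N × Fin n) ℝ) : Matrix (Fin n) (Fin n) ℝ :=
  aLTI A B (1 : Matrix (Fin n) (Fin n) ℝ) F

/-! ### Lyapunov matrices -/

/-- `𝒫(A)`: the positive definite `P` with `Aᵀ P A - P ≺ 0`. -/
def lyapSet {n : ℕ} (A : Matrix (Fin n) (Fin n) ℝ) : Set (Matrix (Fin n) (Fin n) ℝ) :=
  {P | P.PosDef ∧ NegDef (Aᵀ * P * A - P)}

/-- `ℒ_SOF^{(N)}(Σ)`: the stabilizing memory output feedback gain matrices, for which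
`𝒜_LTI(𝓕, Σ)` has (complex) spectral radius less than one. -/
def stabSOF (N : ℕ) {n m p : ℕ} (A : Matrix (Fin n) (Fin n) ℝ) (B : Matrix (Fin n) (Fin m) ℝ)
    (C : Matrix (Fin p) (Fin n) ℝ) : Set (Matrix (Fin N × Fin m) (Fin N × Fin p) ℝ) :=
  {F | F ∈ Set.range gainDown ∧ spectralRadius ℂ ((aLTI A B C F).map (algebraMap ℝ ℂ)) < 1}

/-- `𝒮_SOF^{(N)}(Σ) = ⋃_{𝓕 ∈ ℒ_SOF^{(N)}(Σ)} 𝒫(𝒜_LTI(𝓕, Σ))`. -/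
def lyapSOF (N : ℕ) {n m p : ℕ} (A : Matrix (Fin n) (Fin n) ℝ) (B : Matrix (Fin n) (Fin m) ℝ)
    (C : Matrix (Fin p) (Fin n) ℝ) : Set (Matrix (Fin n) (Fin n) ℝ) :=
  ⋃ F ∈ stabSOF N A B C, lyapSet (aLTI A B C F)

/-! ### The matrix inequalities -/

/-- `𝒳_δ(P, γ) = (-γ e_{(N+1,1)} e_{(N+1,1)}ᵀ + e_{(N+1,δ+1)} e_{(N+1,δ+1)}ᵀ) ⊗ P`. -/
def xMat (N δ : ℕ) {n : ℕ} (P : Matrix (Fin n) (Fin n) ℝ) (γ : ℝ) :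
    Matrix (Fin (N + 1) × Fin n) (Fin (N + 1) × Fin n) ℝ :=
  (-(γ • Matrix.vecMulVec (unitVec (N + 1) 1) (unitVec (N + 1) 1))
    + Matrix.vecMulVec (unitVec (N + 1) (δ + 1)) (unitVec (N + 1) (δ + 1))) ⊗ₖ P

/-- `Π_N = [[e_{(N,1)}ᵀ ⊗ I_n, 0], [I_N ⊗ A, I_N ⊗ B]]`; its rows are one block row, followed by
`N` block rows. -/
def piMat (N : ℕ) {n m : ℕ} (A : Matrix (Fin n) (Fin n) ℝ) (B : Matrix (Fin n) (Fin m) ℝ) :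
    Matrix (Fin (N + 1) × Fin n) ((Fin N × Fin n) ⊕ (Fin N × Fin m)) ℝ :=
  Matrix.of fun r c =>
    Fin.cases (motive := fun _ => ℝ)
      (Matrix.fromCols
        (Matrix.replicateRow Unit (unitVec N 1) ⊗ₖ (1 : Matrix (Fin n) (Fin n) ℝ))
        (0 : Matrix (Unit × Fin n) (Fin N × Fin m) ℝ) ((), r.2) c)
      (fun i => Matrix.fromCols
        ((1 : Matrix (Fin N) (Fin N) ℝ) ⊗ₖ A)
        ((1 : Matrix (Fin N) (Fin N) ℝ) ⊗ₖ B) (i, r.2) c) r.1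

/-- `ℋ(𝓕) = [[𝓕, -I_N ⊗ I_m], [ℒ_{N-1} ⊗ A - ℛ_{N-1} ⊗ I_n, ℒ_{N-1} ⊗ B]]`. -/
def hMat {N n m : ℕ} (A : Matrix (Fin n) (Fin n) ℝ) (B : Matrix (Fin n) (Fin m) ℝ)
    (F : Matrix (Fin N × Fin m) (Fin N × Fin n) ℝ) :
    Matrix ((Fin N × Fin m) ⊕ (Fin (N - 1) × Fin n)) ((Fin N × Fin n) ⊕ (Fin N × Fin m)) ℝ :=
  Matrix.fromBlocks
    F
    (-((1 : Matrix (Fin N) (Fin N) ℝ) ⊗ₖ (1 : Matrix (Fin m) (Fin m) ℝ)))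
    (leftSel (N - 1) N ⊗ₖ A - rightSel (N - 1) N ⊗ₖ (1 : Matrix (Fin n) (Fin n) ℝ))
    (leftSel (N - 1) N ⊗ₖ B)

/-- `𝒞(𝓕) = [[𝓕 (I_N ⊗ C), -I_N ⊗ I_m], [ℒ_{N-1} ⊗ A - ℛ_{N-1} ⊗ I_n, ℒ_{N-1} ⊗ B]]`. -/
def cMat {N n m p : ℕ} (A : Matrix (Fin n) (Fin n) ℝ) (B : Matrix (Fin n) (Fin m) ℝ)
    (C : Matrix (Fin p) (Fin n) ℝ) (F : Matrix (Fin N × Fin m) (Fin N × Fin p) ℝ) :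
    Matrix ((Fin N × Fin m) ⊕ (Fin (N - 1) × Fin n)) ((Fin N × Fin n) ⊕ (Fin N × Fin m)) ℝ :=
  Matrix.fromBlocks
    (F * ((1 : Matrix (Fin N) (Fin N) ℝ) ⊗ₖ C))
    (-((1 : Matrix (Fin N) (Fin N) ℝ) ⊗ₖ (1 : Matrix (Fin m) (Fin m) ℝ)))
    (leftSel (N - 1) N ⊗ₖ A - rightSel (N - 1) N ⊗ₖ (1 : Matrix (Fin n) (Fin n) ℝ))
    (leftSel (N - 1) N ⊗ₖ B)

/-- The bilinear matrix inequalities `P ≻ 0` and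
`Π_Nᵀ 𝒳_N(P, 1) Π_N + He{M 𝒞(𝓕)} ≺ 0` in the unknowns `P`, `M`, `𝓕`. -/
def BMI {N n m p : ℕ} (A : Matrix (Fin n) (Fin n) ℝ) (B : Matrix (Fin n) (Fin m) ℝ)
    (C : Matrix (Fin p) (Fin n) ℝ) (P : Matrix (Fin n) (Fin n) ℝ)
    (M : Matrix ((Fin N × Fin n) ⊕ (Fin N × Fin m)) ((Fin N × Fin m) ⊕ (Fin (N - 1) × Fin n)) ℝ)
    (F : Matrix (Fin N × Fin m) (Fin N × Fin p) ℝ) : Prop :=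
  P.PosDef ∧
    NegDef ((piMat N A B)ᵀ * xMat N N P 1 * piMat N A B + He (M * cMat A B C F))

/-- `(P, 𝓙, 𝓖)` is a solution of Ebihara's linear matrix inequality: `P` is symmetric, `𝓙` and `𝓖`
are block upper triangular, and
`𝒳_N(P, 1) + He{(ℒ_Nᵀ ⊗ A) 𝓖 (ℛ_N ⊗ I_n) + (ℒ_Nᵀ ⊗ B) 𝓙 (ℛ_N ⊗ I_n)
  - (ℛ_Nᵀ ⊗ I_n) 𝓖 (ℛ_N ⊗ I_n)} ≺ 0`. -/
structure EbiharaLMI {N n m : ℕ} (A : Matrix (Fin n) (Fin n) ℝ) (B : Matrix (Fin n) (Fin m) ℝ)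
    (P : Matrix (Fin n) (Fin n) ℝ) (J : Matrix (Fin N × Fin m) (Fin N × Fin n) ℝ)
    (G : Matrix (Fin N × Fin n) (Fin N × Fin n) ℝ) : Prop where
  symm : P.IsSymm
  upperJ : IsBlockUpper J
  upperG : IsBlockUpper G
  lmi : NegDef (xMat N N P 1 + He (
    ((leftSel N (N + 1))ᵀ ⊗ₖ A) * G
        * (rightSel N (N + 1) ⊗ₖ (1 : Matrix (Fin n) (Fin n) ℝ))
      + ((leftSel N (N + 1))ᵀ ⊗ₖ B) * J
        * (rightSel N (N + 1) ⊗ₖ (1 : Matrix (Fin n) (Fin n) ℝ))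
      - ((rightSel N (N + 1))ᵀ ⊗ₖ (1 : Matrix (Fin n) (Fin n) ℝ)) * G
        * (rightSel N (N + 1) ⊗ₖ (1 : Matrix (Fin n) (Fin n) ℝ))))

/-- The memory state-feedback gain `𝓕^{(N,↓)} = (T_N ⊗ I_m) 𝓙 𝓖⁻¹ (T_N ⊗ I_n)`. -/
def stateGain {N n m : ℕ} (J : Matrix (Fin N × Fin m) (Fin N × Fin n) ℝ)
    (G : Matrix (Fin N × Fin n) (Fin N × Fin n) ℝ) :
    Matrix (Fin N × Fin m) (Fin N × Fin n) ℝ :=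
  (flip N ⊗ₖ (1 : Matrix (Fin m) (Fin m) ℝ)) * J * G⁻¹
    * (flip N ⊗ₖ (1 : Matrix (Fin n) (Fin n) ℝ))

end

end PTVM

/-!
The kernel of `𝒞(𝓕)` consists of the closed-loop trajectories over one period, and on such a
trajectory the quadratic form of `Π_Nᵀ 𝒳_N(P) Π_N` is the increment of `xᵀ P x` from `x(0)` to
`x(N)`. So this form is negative on the kernel exactly when `P` is a Lyapunov matrix for
`𝒜_LTI(𝓕, Σ)`, and `ℋ(𝓕)` is the case `C = I`.

The elimination lemma decouples the matrix inequality: a `𝒱` with `Q + He{ℋᵀ 𝒱 𝒞} ≺ 0` exists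
if and only if the form `Q` is negative on the kernels of `ℋ` and of `𝒞`. On the
`Q`-orthogonal complement of their intersection these kernels are disjoint, and `𝒱` is written down
from projections onto them.

Both gains have to be causal, that is block lower triangular, for the trajectories to be determined
by `x(0)`. For the state-feedback gain, testing Ebihara's inequality on vectors with one nonzero
block shows that the diagonal blocks of `𝓖` are invertible. Hence `𝓙 𝓖⁻¹` is block upper
triangular, and conjugation with the flips `T_N` makes it block lower triangular.
-/

namespace PTVM

section Elimination

variable {𝕜 E F G : Type*} [Field 𝕜] [AddCommGroup E] [Module 𝕜 E] [AddCommGroup F] [Module 𝕜 F]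
  [AddCommGroup G] [Module 𝕜 G]

theorem exists_comp_comp_eq_self (f : E →ₗ[𝕜] F) : ∃ g : F →ₗ[𝕜] E, ∀ x, f (g (f x)) = f x := by
  obtain ⟨s, hs⟩ := f.rangeRestrict.exists_rightInverse_of_surjective f.range_rangeRestrict
  obtain ⟨g, hg⟩ := s.exists_extend
  refine ⟨g, fun x => ?_⟩
  have hgx : g (f x) = s (f.rangeRestrict x) := LinearMap.congr_fun hg (f.rangeRestrict x)
  rw [hgx]
  exact congrArg Subtype.val (LinearMap.congr_fun hs (f.rangeRestrict x))

theorem exists_bilin_apply_apply_eq (f : E →ₗ[𝕜] F) (g : E →ₗ[𝕜] G) {b : LinearMap.BilinForm 𝕜 E}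
    (hf : ∀ x ∈ f.ker, ∀ y, b x y = 0) (hg : ∀ x, ∀ y ∈ g.ker, b x y = 0) :
    ∃ V : F →ₗ[𝕜] G →ₗ[𝕜] 𝕜, ∀ x y, V (f x) (g y) = b x y := by
  obtain ⟨f', hf'⟩ := exists_comp_comp_eq_self f
  obtain ⟨g', hg'⟩ := exists_comp_comp_eq_self g
  refine ⟨b.compl₁₂ f' g', fun x y => ?_⟩
  have hx : b (f' (f x) - x) (g' (g y)) = 0 := hf _ (by simp [hf']) _
  have hy : b x (g' (g y) - y) = 0 := hg _ _ (by simp [hg'])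
  rw [map_sub, LinearMap.sub_apply, sub_eq_zero] at hx
  rw [map_sub, sub_eq_zero] at hy
  rw [LinearMap.compl₁₂_apply, hx, hy]

theorem exists_projection_of_disjoint {U K : Submodule 𝕜 E} (h : Disjoint U K) :
    ∃ p : E →ₗ[𝕜] E, (∀ x, p x ∈ U) ∧ (∀ x ∈ U, p x = x) ∧ ∀ x ∈ K, p x = 0 := by
  obtain ⟨W, hKW, hW⟩ := h.symm.exists_isCompl
  exact ⟨U.projection W hW.symm, Submodule.projection_apply_mem hW.symm,
    fun x hx => Submodule.projection_apply_of_mem_left hW.symm hx,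
    fun x hx => (Submodule.projection_apply_eq_zero_iff hW.symm).2 (hKW hx)⟩

variable [LinearOrder 𝕜]

theorem apply_self_nonpos {Q : LinearMap.BilinForm 𝕜 E} {x : E} (h : x ≠ 0 → Q x x < 0) :
    Q x x ≤ 0 := by
  rcases eq_or_ne x 0 with rfl | hx
  · simp
  · exact (h hx).le

variable [IsStrictOrderedRing 𝕜]

variable (𝕜 E) in
theorem exists_bilinForm_posDef [FiniteDimensional 𝕜 E] :
    ∃ S : LinearMap.BilinForm 𝕜 E, ∀ z, z ≠ 0 → 0 < S z z := by
  let e := (Module.finBasis 𝕜 E).equivFun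
  refine ⟨(dotProductBilin 𝕜 𝕜).compl₁₂ e.toLinearMap e.toLinearMap, fun z hz => ?_⟩
  have he : e z ≠ 0 := e.map_ne_zero_iff.2 hz
  exact (Finset.sum_nonneg fun i _ => mul_self_nonneg (e z i)).lt_of_ne'
    (mt dotProduct_self_eq_zero.1 he)

variable [FiniteDimensional 𝕜 E] {Q : LinearMap.BilinForm 𝕜 E} {K₁ K₂ : Submodule 𝕜 E}

theorem exists_bilin_add_neg_of_disjoint (hQ : Q.IsSymm) (hK : Disjoint K₁ K₂)
    (h₁ : ∀ z ∈ K₁, z ≠ 0 → Q z z < 0) (h₂ : ∀ z ∈ K₂, z ≠ 0 → Q z z < 0) :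
    ∃ b : LinearMap.BilinForm 𝕜 E, (∀ x ∈ K₁, ∀ y, b x y = 0) ∧ (∀ x, ∀ y ∈ K₂, b x y = 0) ∧
      ∀ z, z ≠ 0 → Q z z + b z z < 0 := by
  obtain ⟨p₁, hp₁, hp₁_id, hp₁_zero⟩ := exists_projection_of_disjoint hK
  obtain ⟨p₂, hp₂, hp₂_id, hp₂_zero⟩ := exists_projection_of_disjoint hK.symm
  obtain ⟨S, hS⟩ := exists_bilinForm_posDef 𝕜 E
  let r : E →ₗ[𝕜] E := LinearMap.id - p₁ - p₂
  have hr₁ : ∀ x ∈ K₁, r x = 0 := fun x hx => by simp [r, hp₁_id x hx, hp₂_zero x hx]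
  have hr₂ : ∀ x ∈ K₂, r x = 0 := fun x hx => by simp [r, hp₁_zero x hx, hp₂_id x hx]
  -- Chosen so that `Q z z + b z z = Q (p₁ z) (p₁ z) + Q (p₂ z) (p₂ z) - S (r z) (r z)`.
  let b : LinearMap.BilinForm 𝕜 E := (Q - S).compl₁₂ r r
    - (2 : 𝕜) • Q.compl₁₂ (LinearMap.id - p₁) (LinearMap.id - p₂)
  refine ⟨b, fun x hx y => ?_, fun x y hy => ?_, fun z hz => ?_⟩
  · simp [b, hr₁ x hx, hp₁_id x hx]
  · simp [b, hr₂ y hy, hp₂_id y hy]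
  have hb : Q z z + b z z = Q (p₁ z) (p₁ z) + Q (p₂ z) (p₂ z) - S (r z) (r z) := by
    have hsymm : ∀ x y, Q x y = Q y x := hQ.eq
    simp only [b, r, LinearMap.sub_apply, LinearMap.smul_apply, LinearMap.compl₁₂_apply,
      LinearMap.id_apply, map_sub, smul_eq_mul]
    rw [hsymm (p₁ z) z, hsymm (p₂ z) z, hsymm (p₂ z) (p₁ z)]
    ring
  have hS_nonneg : 0 ≤ S (r z) (r z) := by
    simpa using apply_self_nonpos (Q := -S) (x := r z) (by simpa using hS (r z))
  have hQ₁ := apply_self_nonpos (h₁ _ (hp₁ z))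
  have hQ₂ := apply_self_nonpos (h₂ _ (hp₂ z))
  by_contra! h
  have hp₁z : p₁ z = 0 := by_contra fun h0 => by linarith [h₁ _ (hp₁ z) h0]
  have hp₂z : p₂ z = 0 := by_contra fun h0 => by linarith [h₂ _ (hp₂ z) h0]
  have hrz : r z = 0 := by_contra fun h0 => by linarith [hS _ h0]
  exact hz (by simpa [r, hp₁z, hp₂z] using hrz)

theorem exists_bilin_add_neg (hQ : Q.IsSymm)
    (h₁ : ∀ z ∈ K₁, z ≠ 0 → Q z z < 0) (h₂ : ∀ z ∈ K₂, z ≠ 0 → Q z z < 0) :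
    ∃ b : LinearMap.BilinForm 𝕜 E, (∀ x ∈ K₁, ∀ y, b x y = 0) ∧ (∀ x, ∀ y ∈ K₂, b x y = 0) ∧
      ∀ z, z ≠ 0 → Q z z + b z z < 0 := by
  let L := Q.orthogonal (K₁ ⊓ K₂)
  have hL : IsCompl (K₁ ⊓ K₂) L := by
    refine (LinearMap.BilinForm.isCompl_orthogonal_iff_disjoint hQ.isRefl).2 ?_
    refine Submodule.disjoint_def.2 fun z hz hzL => ?_
    by_contra hz0
    exact (h₁ z hz.1 hz0).ne (hzL z hz)
  let π : E →ₗ[𝕜] L := L.projectionOnto (K₁ ⊓ K₂) hL.symm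
  have hπ : ∀ z, z - π z ∈ K₁ ⊓ K₂ := fun z => Submodule.sub_projection_mem hL.symm z
  obtain ⟨b, hb₁, hb₂, hb⟩ := exists_bilin_add_neg_of_disjoint (Q := Q.restrict L)
    (K₁ := K₁.comap L.subtype) (K₂ := K₂.comap L.subtype) (hQ.restrict L)
    (Submodule.disjoint_def.2 fun z hz₁ hz₂ => Subtype.ext <|
      Submodule.disjoint_def.1 hL.disjoint z ⟨hz₁, hz₂⟩ z.2)
    (fun z hz hz0 => h₁ z hz (by simpa using hz0)) (fun z hz hz0 => h₂ z hz (by simpa using hz0))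
  refine ⟨b.compl₁₂ π π, fun x hx y => hb₁ _ ?_ _, fun x y hy => hb₂ _ _ ?_, fun z hz => ?_⟩
  · simpa using K₁.sub_mem hx (hπ x).1
  · simpa using K₂.sub_mem hy (hπ y).2
  have horth : Q (z - π z) (π z) = 0 := (π z).2 _ (hπ z)
  have hQz : Q z z = Q (z - π z) (z - π z) + Q (π z) (π z) := by
    have h_symm : Q z (π z) = Q (π z) z := hQ.eq _ _
    simp only [map_sub, LinearMap.sub_apply] at horth ⊢
    linarith
  have hb' : ∀ w : L, w ≠ 0 → Q w w + b w w < 0 := hb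
  rcases eq_or_ne (π z) 0 with hπz | hπz
  · have hzK : z ∈ K₁ := by simpa [hπz] using (hπ z).1
    simpa [hπz] using h₁ z hzK hz
  · rw [LinearMap.compl₁₂_apply]
    linarith [hb' _ hπz, apply_self_nonpos (h₁ _ (hπ z).1)]

theorem exists_dotProduct_mulVec_add_neg {ι κ μ : Type*} [Fintype ι] [Fintype κ] [Fintype μ]
    {Q : Matrix ι ι 𝕜} (hQ : Q.IsSymm) {H : Matrix κ ι 𝕜} {C : Matrix μ ι 𝕜}
    (hH : ∀ z, z ≠ 0 → H *ᵥ z = 0 → z ⬝ᵥ (Q *ᵥ z) < 0)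
    (hC : ∀ z, z ≠ 0 → C *ᵥ z = 0 → z ⬝ᵥ (Q *ᵥ z) < 0) :
    ∃ V : Matrix κ μ 𝕜, ∀ z, z ≠ 0 →
      z ⬝ᵥ (Q *ᵥ z) + (H *ᵥ z) ⬝ᵥ (V *ᵥ (C *ᵥ z)) < 0 := by
  classical
  obtain ⟨b, hb₁, hb₂, hb⟩ := exists_bilin_add_neg (K₁ := H.mulVecLin.ker) (K₂ := C.mulVecLin.ker)
    (Matrix.isSymm_toBilin'_iff_isSymm.2 hQ)
    (fun z hz hz0 => by simpa [Matrix.toBilin'_apply'] using hH z hz0 hz)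
    (fun z hz hz0 => by simpa [Matrix.toBilin'_apply'] using hC z hz0 hz)
  obtain ⟨V, hV⟩ := exists_bilin_apply_apply_eq H.mulVecLin C.mulVecLin hb₁ hb₂
  refine ⟨LinearMap.toMatrix₂' 𝕜 V, fun z hz => ?_⟩
  have hVz : (H *ᵥ z) ⬝ᵥ (LinearMap.toMatrix₂' 𝕜 V *ᵥ (C *ᵥ z)) = b z z := by
    rw [← Matrix.toLinearMap₂'_apply', Matrix.toLinearMap₂'_toMatrix', ← hV]
    rfl
  rw [hVz, ← Matrix.toBilin'_apply']
  exact hb z hz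

end Elimination

section QuadraticForms

theorem isSymm_transpose_mul_mul {ι κ R : Type*} [Fintype κ] [CommSemiring R] {P : Matrix κ κ R}
    (hP : P.IsSymm) (S : Matrix κ ι R) : (Sᵀ * P * S).IsSymm := by
  rw [Matrix.IsSymm, Matrix.transpose_mul, Matrix.transpose_mul, Matrix.transpose_transpose, hP.eq,
    Matrix.mul_assoc]

variable {ι κ : Type*} [Fintype ι]

theorem negDef_iff {M : Matrix ι ι ℝ} :
    NegDef M ↔ M.IsSymm ∧ ∀ z, z ≠ 0 → z ⬝ᵥ (M *ᵥ z) < 0 := by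
  simp only [NegDef, Matrix.posDef_iff_dotProduct_mulVec, Matrix.IsHermitian, Matrix.IsSymm,
    Matrix.conjTranspose_eq_transpose_of_trivial, Matrix.transpose_neg, neg_inj, star_trivial,
    Matrix.neg_mulVec, dotProduct_neg, Left.neg_pos_iff]

theorem dotProduct_He_mulVec (M : Matrix ι ι ℝ) (z : ι → ℝ) :
    z ⬝ᵥ (He M *ᵥ z) = 2 * (z ⬝ᵥ (M *ᵥ z)) := by
  rw [He, Matrix.add_mulVec, dotProduct_add, Matrix.mulVec_transpose, dotProduct_comm z,
    ← Matrix.dotProduct_mulVec, two_mul]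

theorem dotProduct_transpose_mul_mulVec {R : Type*} [CommSemiring R] [Fintype κ]
    (S T : Matrix κ ι R) (z : ι → R) : z ⬝ᵥ ((Sᵀ * T) *ᵥ z) = (S *ᵥ z) ⬝ᵥ (T *ᵥ z) := by
  rw [← Matrix.mulVec_mulVec, Matrix.dotProduct_mulVec, Matrix.vecMul_transpose]

theorem exists_negDef_add_He_iff {μ : Type*} [Fintype κ] [Fintype μ] {Q : Matrix ι ι ℝ}
    (hQ : Q.IsSymm) {H : Matrix κ ι ℝ} {C : Matrix μ ι ℝ} :
    (∃ V : Matrix κ μ ℝ, NegDef (Q + He (Hᵀ * V * C))) ↔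
      (∀ z, z ≠ 0 → H *ᵥ z = 0 → z ⬝ᵥ (Q *ᵥ z) < 0) ∧
        ∀ z, z ≠ 0 → C *ᵥ z = 0 → z ⬝ᵥ (Q *ᵥ z) < 0 := by
  have hform : ∀ (V : Matrix κ μ ℝ) z, z ⬝ᵥ ((Q + He (Hᵀ * V * C)) *ᵥ z)
      = z ⬝ᵥ (Q *ᵥ z) + (H *ᵥ z) ⬝ᵥ (((2 : ℝ) • V) *ᵥ (C *ᵥ z)) := fun V z => by
    rw [Matrix.add_mulVec, dotProduct_add, dotProduct_He_mulVec, Matrix.mul_assoc,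
      dotProduct_transpose_mul_mulVec, ← Matrix.mulVec_mulVec, Matrix.smul_mulVec, dotProduct_smul,
      smul_eq_mul]
  constructor
  · rintro ⟨V, hV⟩
    have hneg := (negDef_iff.1 hV).2
    simp only [hform] at hneg
    exact ⟨fun z hz hHz => by simpa [hHz] using hneg z hz,
      fun z hz hCz => by simpa [hCz] using hneg z hz⟩
  · rintro ⟨hH, hC⟩
    obtain ⟨V, hV⟩ := exists_dotProduct_mulVec_add_neg hQ hH hC
    refine ⟨(2⁻¹ : ℝ) • V,
      negDef_iff.2 ⟨hQ.add (Matrix.isSymm_transpose_add_self _), fun z hz => ?_⟩⟩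
    rw [hform, smul_inv_smul₀ two_ne_zero]
    exact hV z hz

end QuadraticForms

section Lyapunov

open scoped MatrixOrder ComplexOrder

theorem posDef_map_algebraMap {ι 𝕜 : Type*} [Finite ι] [RCLike 𝕜] {P : Matrix ι ι ℝ}
    (hP : P.PosDef) : (P.map (algebraMap ℝ 𝕜)).PosDef := by
  classical
  cases nonempty_fintype ι
  have hsemi : (P.map (algebraMap ℝ 𝕜)).PosSemidef := by
    obtain ⟨Y, hY⟩ := CStarAlgebra.nonneg_iff_eq_star_mul_self.1 hP.posSemidef.nonneg
    have hmap : P.map (algebraMap ℝ 𝕜) = (Y.map (algebraMap ℝ 𝕜))ᴴ * Y.map (algebraMap ℝ 𝕜) := by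
      rw [hY, Matrix.map_mul, Matrix.star_eq_conjTranspose, Matrix.conjTranspose_map]
      intro x
      simp
    exact hmap ▸ Matrix.posSemidef_conjTranspose_mul_self _
  refine hsemi.posDef_iff_det_ne_zero.2 ?_
  rw [← RingHom.mapMatrix_apply, ← RingHom.map_det]
  simpa using hP.det_pos.ne'

theorem norm_lt_one_of_posDef_sub {ι 𝕜 : Type*} [Fintype ι] [RCLike 𝕜] {S P : Matrix ι ι 𝕜}
    (hP : P.PosDef) (hS : (P - Sᴴ * P * S).PosDef) {k : 𝕜} {v : ι → 𝕜} (hv : v ≠ 0)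
    (hSv : S *ᵥ v = k • v) : ‖k‖ < 1 := by
  have hpos := RCLike.pos_iff.1 (hP.dotProduct_mulVec_pos hv)
  have hform : star v ⬝ᵥ ((P - Sᴴ * P * S) *ᵥ v)
      = ((1 - ‖k‖ ^ 2 : ℝ) : 𝕜) * (star v ⬝ᵥ (P *ᵥ v)) := by
    rw [Matrix.sub_mulVec, dotProduct_sub, ← Matrix.mulVec_mulVec, ← Matrix.mulVec_mulVec,
      Matrix.dotProduct_mulVec _ Sᴴ, ← Matrix.star_mulVec, hSv, Matrix.mulVec_smul, star_smul,
      smul_dotProduct, dotProduct_smul, smul_smul, smul_eq_mul, RCLike.star_def, RCLike.conj_mul]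
    push_cast
    ring
  have hsub := (RCLike.pos_iff.1 (hS.dotProduct_mulVec_pos hv)).1
  rw [hform, RCLike.re_ofReal_mul] at hsub
  have hk := pos_of_mul_pos_left hsub hpos.1.le
  exact (sq_lt_one_iff₀ (norm_nonneg k)).1 (by linarith)

theorem spectralRadius_lt_of_forall_mem_spectrum {ι : Type*} [Fintype ι] [DecidableEq ι]
    {S : Matrix ι ι ℂ} {r : NNReal} (hr : 0 < r) (h : ∀ k ∈ spectrum ℂ S, ‖k‖₊ < r) :
    spectralRadius ℂ S < r := by
  let _ : NormedRing (Matrix ι ι ℂ) := Matrix.linftyOpNormedRing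
  let _ : NormedAlgebra ℂ (Matrix ι ι ℂ) := Matrix.linftyOpNormedAlgebra
  rcases isEmpty_or_nonempty ι
  · rw [spectrum.SpectralRadius.of_subsingleton]
    exact_mod_cast hr
  · have : CompleteSpace (Matrix ι ι ℂ) := FiniteDimensional.complete ℂ _
    exact spectrum.spectralRadius_lt_of_forall_lt _ h

variable {n : ℕ} {S P : Matrix (Fin n) (Fin n) ℝ}

theorem mem_lyapSet_iff (hP : P.PosDef) : P ∈ lyapSet S ↔
    ∀ x, x ≠ 0 → (S *ᵥ x) ⬝ᵥ (P *ᵥ (S *ᵥ x)) - x ⬝ᵥ (P *ᵥ x) < 0 := by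
  have hsymm : P.IsSymm := by simpa using hP.isHermitian
  have hLyap : NegDef (Sᵀ * P * S - P) ↔ _ :=
    negDef_iff.trans (and_iff_right ((isSymm_transpose_mul_mul hsymm S).sub hsymm))
  refine (and_iff_right hP).trans (hLyap.trans ?_)
  simp only [Matrix.sub_mulVec, dotProduct_sub, Matrix.mul_assoc, dotProduct_transpose_mul_mulVec,
    Matrix.mulVec_mulVec]

theorem spectralRadius_lt_one_of_mem_lyapSet (hP : P ∈ lyapSet S) :
    spectralRadius ℂ (S.map (algebraMap ℝ ℂ)) < 1 := by
  refine spectralRadius_lt_of_forall_mem_spectrum one_pos fun k hk => ?_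
  rw [← Matrix.spectrum_toLin', ← Module.End.hasEigenvalue_iff_mem_spectrum] at hk
  obtain ⟨v, hv⟩ := hk.exists_hasEigenvector
  refine norm_lt_one_of_posDef_sub (posDef_map_algebraMap hP.1) ?_ hv.2
    (by simpa [Matrix.toLin'_apply] using hv.apply_eq_smul)
  have hL : (P - Sᵀ * P * S).PosDef := neg_sub (Sᵀ * P * S) P ▸ hP.2
  convert posDef_map_algebraMap (𝕜 := ℂ) hL using 1
  ext i j
  simp [Matrix.mul_apply]

end Lyapunov

section BlockVectors

variable {R κ ι a b : Type*} [CommSemiring R]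

theorem kronecker_mulVec_uncurry [Fintype ι] [Fintype b] (M : Matrix κ ι R) (A : Matrix a b R)
    (x : ι → b → R) : (M ⊗ₖ A) *ᵥ Function.uncurry x
      = Function.uncurry fun i => ∑ j, M i j • (A *ᵥ x j) := by
  ext ⟨i, r⟩
  simp [Matrix.mulVec, dotProduct, Fintype.sum_prod_type, Finset.mul_sum, mul_assoc]

theorem mulVec_uncurry [Fintype ι] [Fintype b] (M : Matrix (κ × a) (ι × b) R) (x : ι → b → R) :
    M *ᵥ Function.uncurry x
      = Function.uncurry fun i => ∑ j, M.submatrix (Prod.mk i) (Prod.mk j) *ᵥ x j := by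
  ext ⟨i, r⟩
  simp [Matrix.mulVec, dotProduct, Fintype.sum_prod_type]

theorem mulVec_uncurry_single [Fintype ι] [DecidableEq ι] [Fintype b]
    (M : Matrix (κ × a) (ι × b) R) (k : ι) (w : b → R) : M *ᵥ Function.uncurry (Pi.single k w)
      = Function.uncurry fun i => M.submatrix (Prod.mk i) (Prod.mk k) *ᵥ w := by
  rw [mulVec_uncurry]
  refine congrArg Function.uncurry (funext fun i => ?_)
  rw [Finset.sum_eq_single_of_mem k (Finset.mem_univ k), Pi.single_eq_same]
  intro j _ hj
  rw [Pi.single_eq_of_ne hj, Matrix.mulVec_zero]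

theorem dotProduct_transpose_kronecker_mulVec [Fintype κ] [Fintype ι] [Fintype a] [Fintype b]
    (M : Matrix κ ι R) (A : Matrix b a R) (x : ι × b → R) (y : κ × a → R) :
    x ⬝ᵥ ((Mᵀ ⊗ₖ A) *ᵥ y) = ((M ⊗ₖ Aᵀ) *ᵥ x) ⬝ᵥ y := by
  rw [Matrix.dotProduct_mulVec, ← Matrix.mulVec_transpose, ← Matrix.kroneckerMap_transpose,
    Matrix.transpose_transpose]

theorem one_kronecker_mulVec_uncurry [Fintype ι] [DecidableEq ι] [Fintype b] (A : Matrix a b R)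
    (x : ι → b → R) :
    ((1 : Matrix ι ι R) ⊗ₖ A) *ᵥ Function.uncurry x = Function.uncurry fun i => A *ᵥ x i := by
  simp [kronecker_mulVec_uncurry, Matrix.one_apply]

theorem uncurry_dotProduct_uncurry [Fintype ι] [Fintype b] (x y : ι → b → R) :
    Function.uncurry x ⬝ᵥ Function.uncurry y = ∑ i, x i ⬝ᵥ y i :=
  Fintype.sum_prod_type _

theorem uncurry_dotProduct_single_kronecker_mulVec [Fintype ι] [DecidableEq ι] [Fintype b] (k : ι)
    (P : Matrix b b R) (x : ι → b → R) :
    Function.uncurry x ⬝ᵥ ((Matrix.single k k 1 ⊗ₖ P) *ᵥ Function.uncurry x)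
      = x k ⬝ᵥ (P *ᵥ x k) := by
  rw [kronecker_mulVec_uncurry, uncurry_dotProduct_uncurry, Finset.sum_eq_single k]
  · simp [Matrix.single_apply]
  · intro i _ hi
    simp [Matrix.single_apply_of_row_ne hi.symm]
  · simp

variable {K n m : ℕ}

theorem leftSel_kronecker_mulVec_uncurry (A : Matrix (Fin m) (Fin n) ℝ)
    (x : Fin (K + 1) → Fin n → ℝ) : (leftSel K (K + 1) ⊗ₖ A) *ᵥ Function.uncurry x
      = Function.uncurry fun i => A *ᵥ x i.castSucc := by
  have hM : ∀ i j, leftSel K (K + 1) i j = if i.castSucc = j then 1 else 0 := fun i j =>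
    if_congr (by rw [Fin.ext_iff, Fin.val_castSucc, eq_comm]) rfl rfl
  simp [kronecker_mulVec_uncurry, hM]

theorem rightSel_kronecker_mulVec_uncurry (A : Matrix (Fin m) (Fin n) ℝ)
    (x : Fin (K + 1) → Fin n → ℝ) : (rightSel K (K + 1) ⊗ₖ A) *ᵥ Function.uncurry x
      = Function.uncurry fun i => A *ᵥ x i.succ := by
  have hM : ∀ i j, rightSel K (K + 1) i j = if i.succ = j then 1 else 0 := fun i j =>
    if_congr (by rw [Fin.ext_iff, Fin.val_succ, eq_comm]) rfl rfl
  simp [kronecker_mulVec_uncurry, hM]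

theorem xMat_eq_single (N : ℕ) (P : Matrix (Fin n) (Fin n) ℝ) : xMat N N P 1 =
    Matrix.single (Fin.last N) (Fin.last N) 1 ⊗ₖ P - Matrix.single 0 0 1 ⊗ₖ P := by
  have h_first : unitVec (N + 1) 1 = Pi.single 0 1 := by
    ext j
    rw [unitVec, Pi.single_apply]
    exact if_congr (by rw [Fin.ext_iff, Fin.val_zero]; lia) rfl rfl
  have h_last : unitVec (N + 1) (N + 1) = Pi.single (Fin.last N) 1 := by
    ext j
    rw [unitVec, Pi.single_apply]
    exact if_congr (by rw [Fin.ext_iff, Fin.val_last]; lia) rfl rfl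
  rw [xMat, h_first, h_last, one_smul, ← Matrix.single_eq_single_vecMulVec_single,
    ← Matrix.single_eq_single_vecMulVec_single, Matrix.add_kronecker, ← neg_one_smul ℝ,
    Matrix.smul_kronecker, neg_one_smul, neg_add_eq_sub]

theorem isSymm_xMat {N : ℕ} {P : Matrix (Fin n) (Fin n) ℝ} (hP : P.IsSymm) :
    (xMat N N P 1).IsSymm := by
  rw [xMat_eq_single, Matrix.IsSymm, Matrix.transpose_sub, ← Matrix.kroneckerMap_transpose,
    ← Matrix.kroneckerMap_transpose, Matrix.transpose_single, Matrix.transpose_single, hP.eq]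

theorem uncurry_dotProduct_xMat_mulVec {N : ℕ} (P : Matrix (Fin n) (Fin n) ℝ)
    (ξ : Fin (N + 1) → Fin n → ℝ) :
    Function.uncurry ξ ⬝ᵥ (xMat N N P 1 *ᵥ Function.uncurry ξ)
      = ξ (Fin.last N) ⬝ᵥ (P *ᵥ ξ (Fin.last N)) - ξ 0 ⬝ᵥ (P *ᵥ ξ 0) := by
  rw [xMat_eq_single, Matrix.sub_mulVec, dotProduct_sub,
    uncurry_dotProduct_single_kronecker_mulVec, uncurry_dotProduct_single_kronecker_mulVec]

end BlockVectors

section Trajectories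

/-- The counterpart of `IsBlockUpper` for block lower triangular matrices. -/
def IsBlockLower {N a b : ℕ} (F : Matrix (Fin N × Fin a) (Fin N × Fin b) ℝ) : Prop :=
  ∀ i j : Fin N, i < j → ∀ (r : Fin a) (c : Fin b), F (i, r) (j, c) = 0

theorem isBlockLower_gainDown {N m p : ℕ} (F : Fin N → Fin N → Matrix (Fin m) (Fin p) ℝ) :
    IsBlockLower (gainDown F) := fun _ _ hij _ _ => if_pos hij

variable {N n m p : ℕ} (A : Matrix (Fin n) (Fin n) ℝ) (B : Matrix (Fin n) (Fin m) ℝ)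
  (C : Matrix (Fin p) (Fin n) ℝ)

/-- The inputs which the gain `F` produces from the outputs `C (x i)` of a sequence of states. -/
def feedback (F : Matrix (Fin N × Fin m) (Fin N × Fin p) ℝ) (x : Fin N → Fin n → ℝ) :
    Fin N → Fin m → ℝ :=
  Function.curry ((F * ((1 : Matrix (Fin N) (Fin N) ℝ) ⊗ₖ C)) *ᵥ Function.uncurry x)

theorem feedback_apply (F : Matrix (Fin N × Fin m) (Fin N × Fin p) ℝ) (x : Fin N → Fin n → ℝ)
    (i : Fin N) :
    feedback C F x i = ∑ j, F.submatrix (Prod.mk i) (Prod.mk j) *ᵥ (C *ᵥ x j) := by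
  rw [feedback, ← Matrix.mulVec_mulVec, one_kronecker_mulVec_uncurry, mulVec_uncurry,
    Function.curry_uncurry]

theorem IsBlockLower.submatrix_eq_zero {F : Matrix (Fin N × Fin m) (Fin N × Fin p) ℝ}
    (hF : IsBlockLower F) {i j : Fin N} (hij : i < j) :
    F.submatrix (Prod.mk i) (Prod.mk j) = 0 :=
  Matrix.ext (hF i j hij)

theorem IsBlockLower.feedback_congr {F : Matrix (Fin N × Fin m) (Fin N × Fin p) ℝ}
    (hF : IsBlockLower F) {x y : Fin N → Fin n → ℝ} {i : Fin N} (hxy : ∀ j ≤ i, x j = y j) :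
    feedback C F x i = feedback C F y i := by
  rw [feedback_apply, feedback_apply]
  refine Finset.sum_congr rfl fun j _ => ?_
  rcases le_or_gt j i with hji | hij
  · rw [hxy j hji]
  · rw [hF.submatrix_eq_zero hij, Matrix.zero_mulVec, Matrix.zero_mulVec]

theorem IsBlockLower.truncGain {F : Matrix (Fin N × Fin m) (Fin N × Fin p) ℝ}
    (hF : IsBlockLower F) {δ : ℕ} (h : δ ≤ N) : IsBlockLower (truncGain F δ h) :=
  fun _ _ hij r c => hF _ _ (Fin.castLE_lt_castLE_iff h |>.2 hij) r c

theorem IsBlockLower.feedback_truncGain_castSucc {F : Matrix (Fin N × Fin m) (Fin N × Fin p) ℝ}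
    (hF : IsBlockLower F) {δ : ℕ} (h : δ + 1 ≤ N) (x : Fin (δ + 1) → Fin n → ℝ) (i : Fin δ) :
    feedback C (PTVM.truncGain F (δ + 1) h) x i.castSucc
      = feedback C (PTVM.truncGain F δ (Nat.le_of_succ_le h)) (Fin.init x) i := by
  rw [feedback_apply, feedback_apply, Fin.sum_univ_castSucc,
    (hF.truncGain h).submatrix_eq_zero i.castSucc_lt_last, Matrix.zero_mulVec, add_zero]
  rfl

/-- `ξ` is a sequence of successive states of the closed loop of `(A, B, C)` with the gain `F`, over
one period. -/
def IsTrajectory (F : Matrix (Fin N × Fin m) (Fin N × Fin p) ℝ)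
    (ξ : Fin (N + 1) → Fin n → ℝ) : Prop :=
  ∀ i : Fin N, ξ i.succ = A *ᵥ ξ i.castSucc + B *ᵥ feedback C F (Fin.init ξ) i

variable {A B C}

theorem IsTrajectory.ext {F : Matrix (Fin N × Fin m) (Fin N × Fin p) ℝ} (hF : IsBlockLower F)
    {ξ ζ : Fin (N + 1) → Fin n → ℝ} (hξ : IsTrajectory A B C F ξ) (hζ : IsTrajectory A B C F ζ)
    (h : ξ 0 = ζ 0) : ξ = ζ := by
  have h_le : ∀ i, ∀ j ≤ i, ξ j = ζ j := fun i => by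
    induction i using Fin.induction with
    | zero => exact fun j hj => Fin.le_zero_iff.1 hj ▸ h
    | succ i ih =>
      intro j hj
      rcases hj.lt_or_eq with hj | rfl
      · exact ih j (Fin.le_castSucc_iff.2 hj)
      · have hu : feedback C F (Fin.init ξ) i = feedback C F (Fin.init ζ) i :=
          hF.feedback_congr C fun k hk => ih k.castSucc hk
        rw [hξ, hζ, ih _ le_rfl, hu]
  exact funext fun i => h_le i i le_rfl

theorem augMatrix_mulVec_uncurry (F : Matrix (Fin N × Fin m) (Fin N × Fin p) ℝ) {δ : ℕ} (h : δ ≤ N)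
    (x : Fin δ → Fin n → ℝ) : augMatrix A B C F δ h *ᵥ Function.uncurry x
      = Function.uncurry fun i => A *ᵥ x i + B *ᵥ feedback C (truncGain F δ h) x i := by
  have hu : (truncGain F δ h * ((1 : Matrix (Fin δ) (Fin δ) ℝ) ⊗ₖ C)) *ᵥ Function.uncurry x
      = Function.uncurry (feedback C (truncGain F δ h) x) := rfl
  rw [augMatrix, Matrix.add_mulVec, Matrix.mul_assoc, ← Matrix.mulVec_mulVec, hu,
    one_kronecker_mulVec_uncurry, one_kronecker_mulVec_uncurry]
  rfl

theorem curry_stackLTI_succ_mulVec (F : Matrix (Fin N × Fin m) (Fin N × Fin p) ℝ) {δ : ℕ}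
    (h : δ + 1 ≤ N) (x₀ : Fin n → ℝ) :
    Function.curry (stackLTI A B C F (δ + 1) h *ᵥ x₀)
      = Fin.snoc (α := fun _ => Fin n → ℝ)
        (Function.curry (stackLTI A B C F δ (Nat.le_of_succ_le h) *ᵥ x₀))
        (Function.curry (augMatrix A B C F (δ + 1) h *ᵥ
          (stackLTI A B C F δ (Nat.le_of_succ_le h) *ᵥ x₀)) (Fin.last δ)) := by
  ext i r
  refine Fin.lastCases ?_ (fun i => ?_) i
  · rw [Fin.snoc_last, Matrix.mulVec_mulVec]
    simp [Function.curry, stackLTI, Matrix.mulVec]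
  · rw [Fin.snoc_castSucc]
    simp [Function.curry, stackLTI, Matrix.mulVec]

theorem curry_stackLTI_mulVec_zero (F : Matrix (Fin N × Fin m) (Fin N × Fin p) ℝ) {δ : ℕ}
    (h : δ ≤ N) (x₀ : Fin n → ℝ) : Function.curry (stackLTI A B C F δ h *ᵥ x₀) 0 = x₀ := by
  induction δ with
  | zero => exact Matrix.one_mulVec x₀
  | succ δ ih => rw [curry_stackLTI_succ_mulVec, ← Fin.castSucc_zero, Fin.snoc_castSucc, ih]

theorem IsBlockLower.isTrajectory_stackLTI {F : Matrix (Fin N × Fin m) (Fin N × Fin p) ℝ}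
    (hF : IsBlockLower F) {δ : ℕ} (h : δ ≤ N) (x₀ : Fin n → ℝ) :
    IsTrajectory A B C (PTVM.truncGain F δ h) (Function.curry (stackLTI A B C F δ h *ᵥ x₀)) := by
  induction δ with
  | zero => exact fun i => i.elim0
  | succ δ ih =>
    have hδ := Nat.le_of_succ_le h
    have haug := augMatrix_mulVec_uncurry (A := A) (B := B) (C := C) F h
      (Function.curry (stackLTI A B C F δ hδ *ᵥ x₀))
    rw [Function.uncurry_curry] at haug
    rw [curry_stackLTI_succ_mulVec, haug, Function.curry_uncurry]
    intro i
    rw [Fin.init_snoc]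
    refine Fin.lastCases ?_ (fun i => ?_) i
    · rw [Fin.succ_last, Fin.snoc_last, Fin.snoc_castSucc]
    · rw [Fin.succ_castSucc, Fin.snoc_castSucc, Fin.snoc_castSucc,
        hF.feedback_truncGain_castSucc, ih hδ]

theorem IsBlockLower.exists_isTrajectory {F : Matrix (Fin N × Fin m) (Fin N × Fin p) ℝ}
    (hF : IsBlockLower F) (x₀ : Fin n → ℝ) : ∃ ξ, IsTrajectory A B C F ξ ∧ ξ 0 = x₀ :=
  ⟨_, hF.isTrajectory_stackLTI le_rfl x₀, curry_stackLTI_mulVec_zero F le_rfl x₀⟩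

theorem IsTrajectory.apply_last {F : Matrix (Fin N × Fin m) (Fin N × Fin p) ℝ}
    {ξ : Fin (N + 1) → Fin n → ℝ} (hξ : IsTrajectory A B C F ξ) (hF : IsBlockLower F) :
    ξ (Fin.last N) = aLTI A B C F *ᵥ ξ 0 := by
  have hstack : ξ = Function.curry (stackLTI A B C F N le_rfl *ᵥ ξ 0) :=
    hξ.ext hF (hF.isTrajectory_stackLTI le_rfl (ξ 0)) (curry_stackLTI_mulVec_zero F le_rfl _).symm
  exact congrFun hstack (Fin.last N)

end Trajectories

section Kernel

/-- The states `ξ 0, …, ξ (N - 1)` over one period, stacked on the inputs which the gain `F`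
produces from them. -/
def closedLoop {N n m p : ℕ} (C : Matrix (Fin p) (Fin n) ℝ)
    (F : Matrix (Fin N × Fin m) (Fin N × Fin p) ℝ) (ξ : Fin (N + 1) → Fin n → ℝ) :
    (Fin N × Fin n) ⊕ (Fin N × Fin m) → ℝ :=
  Sum.elim (Function.uncurry (Fin.init ξ)) (Function.uncurry (feedback C F (Fin.init ξ)))

variable {K n m p : ℕ} {A : Matrix (Fin n) (Fin n) ℝ} {B : Matrix (Fin n) (Fin m) ℝ}
  {C : Matrix (Fin p) (Fin n) ℝ} {F : Matrix (Fin (K + 1) × Fin m) (Fin (K + 1) × Fin p) ℝ}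
  {ξ : Fin (K + 2) → Fin n → ℝ}

theorem cMat_mulVec_sumElim (x : Fin (K + 1) → Fin n → ℝ) (u : Fin (K + 1) → Fin m → ℝ) :
    cMat A B C F *ᵥ Sum.elim (Function.uncurry x) (Function.uncurry u)
      = Sum.elim (Function.uncurry (feedback C F x - u)) (Function.uncurry fun i : Fin K =>
          A *ᵥ x i.castSucc + B *ᵥ u i.castSucc - x i.succ) := by
  rw [cMat, Matrix.fromBlocks_mulVec, Sum.elim_comp_inl, Sum.elim_comp_inr]
  congr 1
  · rw [Matrix.one_kronecker_one, Matrix.neg_mulVec, Matrix.one_mulVec, ← sub_eq_add_neg]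
    rfl
  · change (leftSel K (K + 1) ⊗ₖ A - rightSel K (K + 1) ⊗ₖ (1 : Matrix (Fin n) (Fin n) ℝ))
      *ᵥ Function.uncurry x + (leftSel K (K + 1) ⊗ₖ B) *ᵥ Function.uncurry u = _
    rw [Matrix.sub_mulVec, leftSel_kronecker_mulVec_uncurry, leftSel_kronecker_mulVec_uncurry,
      rightSel_kronecker_mulVec_uncurry, sub_add_eq_add_sub]
    simp only [Matrix.one_mulVec]
    rfl

theorem cMat_mulVec_sumElim_eq_zero_iff (x : Fin (K + 1) → Fin n → ℝ)
    (u : Fin (K + 1) → Fin m → ℝ) :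
    cMat A B C F *ᵥ Sum.elim (Function.uncurry x) (Function.uncurry u) = 0 ↔
      u = feedback C F x ∧ ∀ i : Fin K, x i.succ = A *ᵥ x i.castSucc + B *ᵥ u i.castSucc := by
  have h_uncurry : ∀ {k l : ℕ} (v : Fin k → Fin l → ℝ), Function.uncurry v = 0 ↔ v = 0 :=
    fun _ => (Equiv.curry _ _ _).symm.injective.eq_iff' rfl
  rw [cMat_mulVec_sumElim, ← Sum.elim_zero_zero, Sum.elim_eq_iff, h_uncurry, sub_eq_zero,
    eq_comm (a := u)]
  refine and_congr_right fun _ => (h_uncurry _).trans (funext_iff.trans (forall_congr' fun i => ?_))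
  rw [Pi.zero_apply, sub_eq_zero, eq_comm]

theorem cMat_mulVec_eq_zero_iff {z : (Fin (K + 1) × Fin n) ⊕ (Fin (K + 1) × Fin m) → ℝ} :
    cMat A B C F *ᵥ z = 0 ↔ ∃ ξ, IsTrajectory A B C F ξ ∧ z = closedLoop C F ξ := by
  constructor
  · intro hz
    let x := Function.curry (z ∘ Sum.inl)
    have hz_elim : z
        = Sum.elim (Function.uncurry x) (Function.uncurry (Function.curry (z ∘ Sum.inr))) :=
      (Sum.elim_comp_inl_inr z).symm
    rw [hz_elim, cMat_mulVec_sumElim_eq_zero_iff] at hz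
    obtain ⟨hu, hx⟩ := hz
    rw [hu] at hx
    refine ⟨Fin.snoc x (A *ᵥ x (Fin.last K) + B *ᵥ feedback C F x (Fin.last K)), fun i => ?_, ?_⟩
    · rw [Fin.init_snoc]
      refine Fin.lastCases ?_ (fun i => ?_) i
      · rw [Fin.succ_last, Fin.snoc_last, Fin.snoc_castSucc]
      · rw [Fin.succ_castSucc, Fin.snoc_castSucc, Fin.snoc_castSucc, hx]
    · rw [closedLoop, Fin.init_snoc, ← hu]
      exact hz_elim
  · rintro ⟨ξ, hξ, rfl⟩
    exact (cMat_mulVec_sumElim_eq_zero_iff _ _).2 ⟨rfl, fun i => hξ i.castSucc⟩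

theorem IsTrajectory.piMat_mulVec_closedLoop (hξ : IsTrajectory A B C F ξ) :
    piMat (K + 1) A B *ᵥ closedLoop C F ξ = Function.uncurry ξ := by
  have h_unit : Matrix.replicateRow Unit (unitVec (K + 1) 1)
      = Matrix.of fun _ => Pi.single 0 1 := by
    ext _ j
    refine (if_congr ?_ rfl rfl).trans (Pi.single_apply ..).symm
    rw [Fin.ext_iff, Fin.val_zero]
    lia
  ext ⟨i, r⟩
  refine Fin.cases ?_ (fun i => ?_) i
  · have h_first : (piMat (K + 1) A B *ᵥ closedLoop C F ξ) (0, r)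
        = (Matrix.fromCols
          (Matrix.replicateRow Unit (unitVec (K + 1) 1) ⊗ₖ (1 : Matrix (Fin n) (Fin n) ℝ))
          (0 : Matrix (Unit × Fin n) (Fin (K + 1) × Fin m) ℝ) *ᵥ closedLoop C F ξ) ((), r) := rfl
    rw [h_first, closedLoop, Matrix.fromCols_mulVec_sumElim, Matrix.zero_mulVec, add_zero, h_unit,
      kronecker_mulVec_uncurry]
    simp [Fin.init, Pi.single_apply]
  · have h_succ : (piMat (K + 1) A B *ᵥ closedLoop C F ξ) (i.succ, r)
        = (Matrix.fromCols ((1 : Matrix (Fin (K + 1)) (Fin (K + 1)) ℝ) ⊗ₖ A)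
          ((1 : Matrix (Fin (K + 1)) (Fin (K + 1)) ℝ) ⊗ₖ B) *ᵥ closedLoop C F ξ) (i, r) := rfl
    rw [h_succ, closedLoop, Matrix.fromCols_mulVec_sumElim, one_kronecker_mulVec_uncurry,
      one_kronecker_mulVec_uncurry]
    exact congrFun (hξ i).symm r

theorem IsTrajectory.dotProduct_closedLoop (hξ : IsTrajectory A B C F ξ) (hF : IsBlockLower F)
    (P : Matrix (Fin n) (Fin n) ℝ) :
    closedLoop C F ξ ⬝ᵥ (((piMat (K + 1) A B)ᵀ * xMat (K + 1) (K + 1) P 1 * piMat (K + 1) A B)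
        *ᵥ closedLoop C F ξ)
      = (aLTI A B C F *ᵥ ξ 0) ⬝ᵥ (P *ᵥ (aLTI A B C F *ᵥ ξ 0)) - ξ 0 ⬝ᵥ (P *ᵥ ξ 0) := by
  rw [Matrix.mul_assoc, dotProduct_transpose_mul_mulVec, ← Matrix.mulVec_mulVec,
    hξ.piMat_mulVec_closedLoop, uncurry_dotProduct_xMat_mulVec, hξ.apply_last hF]

theorem IsTrajectory.closedLoop_eq_zero_iff (hξ : IsTrajectory A B C F ξ) (hF : IsBlockLower F) :
    closedLoop C F ξ = 0 ↔ ξ 0 = 0 := by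
  have h_zero : feedback C F 0 = 0 := congrArg Function.curry (Matrix.mulVec_zero _)
  constructor
  · exact fun h => funext fun r => congrFun h (Sum.inl (0, r))
  · intro h
    have h_traj : IsTrajectory A B C F 0 := fun i => by
      change 0 = A *ᵥ 0 + B *ᵥ feedback C F 0 i
      rw [h_zero, Pi.zero_apply, Matrix.mulVec_zero, Matrix.mulVec_zero, add_zero]
    rw [hξ.ext hF h_traj h]
    have h_init : Fin.init (0 : Fin (K + 2) → Fin n → ℝ) = 0 := rfl
    rw [closedLoop, h_init, h_zero]
    exact Sum.elim_zero_zero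

theorem mem_lyapSet_aLTI_iff (hF : IsBlockLower F) {P : Matrix (Fin n) (Fin n) ℝ}
    (hP : P.PosDef) :
    P ∈ lyapSet (aLTI A B C F) ↔ ∀ z, z ≠ 0 → cMat A B C F *ᵥ z = 0 →
      z ⬝ᵥ (((piMat (K + 1) A B)ᵀ * xMat (K + 1) (K + 1) P 1 * piMat (K + 1) A B) *ᵥ z) < 0 := by
  rw [mem_lyapSet_iff hP]
  constructor
  · intro h z hz hCz
    obtain ⟨ξ, hξ, rfl⟩ := cMat_mulVec_eq_zero_iff.1 hCz
    rw [hξ.dotProduct_closedLoop hF]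
    exact h _ (mt (hξ.closedLoop_eq_zero_iff hF).2 hz)
  · intro h x₀ hx₀
    obtain ⟨ξ, hξ, rfl⟩ := hF.exists_isTrajectory (A := A) (B := B) (C := C) x₀
    rw [← hξ.dotProduct_closedLoop hF]
    exact h _ (mt (hξ.closedLoop_eq_zero_iff hF).1 hx₀) (cMat_mulVec_eq_zero_iff.2 ⟨ξ, hξ, rfl⟩)

theorem hMat_eq_cMat {N : ℕ} (F : Matrix (Fin N × Fin m) (Fin N × Fin n) ℝ) :
    hMat A B F = cMat A B (1 : Matrix (Fin n) (Fin n) ℝ) F := by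
  rw [hMat, cMat, Matrix.one_kronecker_one, Matrix.one_kronecker_one, Matrix.mul_one]

theorem exists_BMI_iff {P : Matrix (Fin n) (Fin n) ℝ} (hP : P.PosDef) (hF : IsBlockLower F)
    {F' : Matrix (Fin (K + 1) × Fin m) (Fin (K + 1) × Fin n) ℝ} (hF' : IsBlockLower F') :
    (∃ V : Matrix ((Fin (K + 1) × Fin m) ⊕ (Fin (K + 1 - 1) × Fin n))
        ((Fin (K + 1) × Fin m) ⊕ (Fin (K + 1 - 1) × Fin n)) ℝ,
        BMI A B C P ((hMat A B F')ᵀ * V) F) ↔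
      P ∈ lyapSet (aLTIState A B F') ∧ P ∈ lyapSet (aLTI A B C F) := by
  have hsymm : P.IsSymm := by simpa using hP.isHermitian
  simp only [BMI, hP, true_and]
  rw [exists_negDef_add_He_iff (isSymm_transpose_mul_mul (isSymm_xMat hsymm) _), hMat_eq_cMat,
    aLTIState, mem_lyapSet_aLTI_iff hF' hP, mem_lyapSet_aLTI_iff hF hP]

end Kernel

section Ebihara

variable {N n m a b c : ℕ} {A : Matrix (Fin n) (Fin n) ℝ} {B : Matrix (Fin n) (Fin m) ℝ}
  {P : Matrix (Fin n) (Fin n) ℝ} {J : Matrix (Fin N × Fin m) (Fin N × Fin n) ℝ}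
  {G : Matrix (Fin N × Fin n) (Fin N × Fin n) ℝ}

theorem IsBlockUpper.submatrix_eq_zero {X : Matrix (Fin N × Fin a) (Fin N × Fin b) ℝ}
    (hX : IsBlockUpper X) {i j : Fin N} (hij : j < i) :
    X.submatrix (Prod.mk i) (Prod.mk j) = 0 :=
  Matrix.ext (hX i j hij)

theorem IsBlockUpper.mul {X : Matrix (Fin N × Fin a) (Fin N × Fin b) ℝ}
    {Y : Matrix (Fin N × Fin b) (Fin N × Fin c) ℝ} (hX : IsBlockUpper X) (hY : IsBlockUpper Y) :
    IsBlockUpper (X * Y) := fun i j hij r s => by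
  rw [Matrix.mul_apply]
  refine Finset.sum_eq_zero fun ⟨k, t⟩ _ => ?_
  rcases lt_or_ge k i with hk | hk
  · rw [hX i k hk, zero_mul]
  · rw [hY k j (hij.trans_le hk), mul_zero]

theorem IsBlockUpper.inv (hG : IsBlockUpper G) (hdet : G.det ≠ 0) : IsBlockUpper G⁻¹ := by
  have : Invertible G := G.invertibleOfIsUnitDet hdet.isUnit
  have h_triangular : G.BlockTriangular Prod.fst := fun i j hij => hG i.1 j.1 hij i.2 j.2
  exact fun i j hij r s => Matrix.blockTriangular_inv_of_blockTriangular h_triangular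
    (i := (i, r)) (j := (j, s)) hij

theorem IsBlockUpper.det_ne_zero (hG : IsBlockUpper G)
    (h_diag : ∀ k (w : Fin n → ℝ), G.submatrix (Prod.mk k) (Prod.mk k) *ᵥ w = 0 → w = 0) :
    G.det ≠ 0 := by
  refine fun hdet => (Matrix.exists_mulVec_eq_zero_iff.2 hdet).elim fun η ⟨hη0, hη⟩ => hη0 ?_
  let y := Function.curry η
  have hrow : ∀ k, ∑ j, G.submatrix (Prod.mk k) (Prod.mk j) *ᵥ y j = 0 := fun k => by
    rw [← Function.uncurry_curry η, mulVec_uncurry] at hη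
    exact funext fun r => congrFun hη (k, r)
  suffices hy : ∀ k, y k = 0 from funext fun i => congrFun (hy i.1) i.2
  intro k
  induction k using WellFoundedGT.induction with
  | _ k ih =>
    refine h_diag k _ ?_
    rw [← hrow k, Finset.sum_eq_single_of_mem k (Finset.mem_univ k)]
    intro j _ hj
    rcases hj.lt_or_gt with hjk | hkj
    · rw [hG.submatrix_eq_zero hjk, Matrix.zero_mulVec]
    · rw [ih j hkj, Matrix.mulVec_zero]

theorem IsBlockUpper.uncurry_dotProduct_mulVec_single
    {X : Matrix (Fin N × Fin a) (Fin N × Fin b) ℝ} (hX : IsBlockUpper X) {k : Fin N}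
    {y : Fin N → Fin a → ℝ} (hy : ∀ i < k, y i = 0) (w : Fin b → ℝ) :
    Function.uncurry y ⬝ᵥ (X *ᵥ Function.uncurry (Pi.single k w))
      = y k ⬝ᵥ (X.submatrix (Prod.mk k) (Prod.mk k) *ᵥ w) := by
  rw [mulVec_uncurry_single, uncurry_dotProduct_uncurry]
  refine Finset.sum_eq_single_of_mem k (Finset.mem_univ k) fun i _ hi => ?_
  rcases hi.lt_or_gt with hik | hki
  · rw [hy i hik, zero_dotProduct]
  · rw [hX.submatrix_eq_zero hki, Matrix.zero_mulVec, dotProduct_zero]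

theorem EbiharaLMI.form_neg (h : EbiharaLMI A B P J G) {ξ : Fin (N + 1) → Fin n → ℝ}
    (hξ : ξ ≠ 0) :
    ξ (Fin.last N) ⬝ᵥ (P *ᵥ ξ (Fin.last N)) - ξ 0 ⬝ᵥ (P *ᵥ ξ 0)
      + 2 * ((Function.uncurry fun i => Aᵀ *ᵥ Fin.init ξ i) ⬝ᵥ
            (G *ᵥ Function.uncurry (Fin.tail ξ))
          + (Function.uncurry fun i => Bᵀ *ᵥ Fin.init ξ i) ⬝ᵥ
            (J *ᵥ Function.uncurry (Fin.tail ξ))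
          - Function.uncurry (Fin.tail ξ) ⬝ᵥ (G *ᵥ Function.uncurry (Fin.tail ξ))) < 0 := by
  have h_left : ∀ {l : ℕ} (M : Matrix (Fin n) (Fin l) ℝ),
      (leftSel N (N + 1) ⊗ₖ Mᵀ) *ᵥ Function.uncurry ξ
        = Function.uncurry fun i => Mᵀ *ᵥ Fin.init ξ i :=
    fun M => leftSel_kronecker_mulVec_uncurry Mᵀ ξ
  have h_right : (rightSel N (N + 1) ⊗ₖ (1 : Matrix (Fin n) (Fin n) ℝ)) *ᵥ Function.uncurry ξ
      = Function.uncurry (Fin.tail ξ) := by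
    simp only [rightSel_kronecker_mulVec_uncurry, Matrix.one_mulVec]
    rfl
  have h_neg := (negDef_iff.1 h.lmi).2 (Function.uncurry ξ)
    (fun h0 => hξ (congrArg Function.curry h0))
  rw [Matrix.add_mulVec, dotProduct_add, dotProduct_He_mulVec, uncurry_dotProduct_xMat_mulVec,
    Matrix.sub_mulVec, Matrix.add_mulVec, dotProduct_sub, dotProduct_add] at h_neg
  simpa only [← Matrix.mulVec_mulVec, dotProduct_transpose_kronecker_mulVec,
    Matrix.transpose_one, h_left, h_right] using h_neg

theorem EbiharaLMI.dotProduct_mulVec_pos [NeZero N] (h : EbiharaLMI A B P J G) {w : Fin n → ℝ}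
    (hw : w ≠ 0) : 0 < w ⬝ᵥ (P *ᵥ w) := by
  have h_tail : Fin.tail (Pi.single 0 w : Fin (N + 1) → Fin n → ℝ) = 0 :=
    funext fun i => Pi.single_eq_of_ne (Fin.succ_ne_zero i) w
  have h_neg := h.form_neg (ξ := Pi.single 0 w) (Pi.single_ne_zero_iff.2 hw)
  rw [h_tail, Pi.single_eq_same, Pi.single_eq_of_ne (Fin.last_pos' (n := N)).ne'] at h_neg
  simpa [show Function.uncurry (0 : Fin N → Fin n → ℝ) = 0 from rfl] using h_neg

theorem EbiharaLMI.diag_dotProduct_mulVec_pos (h : EbiharaLMI A B P J G) (k : Fin N)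
    {w : Fin n → ℝ} (hw : w ≠ 0) :
    0 < w ⬝ᵥ (G.submatrix (Prod.mk k) (Prod.mk k) *ᵥ w) := by
  have : NeZero N := ⟨k.pos.ne'⟩
  let ξ : Fin (N + 1) → Fin n → ℝ := Pi.single k.succ w
  have h_tail : Fin.tail ξ = Pi.single k w :=
    funext fun i => by simp [ξ, Fin.tail, Pi.single_apply]
  have h_init : ∀ i ≤ k, Fin.init ξ i = 0 := fun i hi =>
    Pi.single_eq_of_ne (M := fun _ => Fin n → ℝ) (Fin.castSucc_lt_succ_iff.2 hi).ne w
  have h_coupling : ∀ {l : ℕ} (M : Matrix (Fin n) (Fin l) ℝ)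
      {X : Matrix (Fin N × Fin l) (Fin N × Fin n) ℝ}, IsBlockUpper X →
      (Function.uncurry fun i => Mᵀ *ᵥ Fin.init ξ i) ⬝ᵥ
        (X *ᵥ Function.uncurry (Pi.single k w)) = 0 := fun M X hX => by
    have hM : ∀ i ≤ k, Mᵀ *ᵥ Fin.init ξ i = 0 := fun i hi => by rw [h_init i hi, Matrix.mulVec_zero]
    rw [hX.uncurry_dotProduct_mulVec_single fun i hi => hM i hi.le, hM k le_rfl, zero_dotProduct]
  have h_last : 0 ≤ ξ (Fin.last N) ⬝ᵥ (P *ᵥ ξ (Fin.last N)) := by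
    rcases eq_or_ne (ξ (Fin.last N)) 0 with h0 | h0
    · rw [h0, zero_dotProduct]
    · exact (h.dotProduct_mulVec_pos h0).le
  have h_first : ξ 0 = 0 := Pi.single_eq_of_ne (Fin.succ_ne_zero k).symm w
  have h_neg := h.form_neg (ξ := ξ) (Pi.single_ne_zero_iff.2 hw)
  rw [h_tail, h_coupling A h.upperG, h_coupling B h.upperJ, h_first, zero_dotProduct,
    h.upperG.uncurry_dotProduct_mulVec_single
      (fun i hi => Pi.single_eq_of_ne (M := fun _ => _) hi.ne w),
    Pi.single_eq_same] at h_neg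
  linarith

theorem EbiharaLMI.det_ne_zero (h : EbiharaLMI A B P J G) : G.det ≠ 0 :=
  h.upperG.det_ne_zero fun k w hw => by
    by_contra hw0
    simpa [hw] using h.diag_dotProduct_mulVec_pos k hw0

theorem flip_apply (i j : Fin N) : flip N i j = if j = i.rev then 1 else 0 := by
  refine if_congr ?_ rfl rfl
  rw [Fin.ext_iff, Fin.val_rev]
  lia

theorem flip_kronecker_mul_mul_flip_kronecker (X : Matrix (Fin N × Fin a) (Fin N × Fin b) ℝ) :
    (flip N ⊗ₖ (1 : Matrix (Fin a) (Fin a) ℝ)) * X * (flip N ⊗ₖ (1 : Matrix (Fin b) (Fin b) ℝ))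
      = X.submatrix (Prod.map Fin.rev id) (Prod.map Fin.rev id) := by
  have hrev : ∀ i j : Fin N, j = i.rev ↔ i = j.rev := fun i j => by
    rw [eq_comm, Fin.rev_eq_iff]
  ext ⟨i, r⟩ ⟨j, s⟩
  simp [Matrix.mul_apply, Fintype.sum_prod_type, flip_apply, Matrix.one_apply, hrev _ j]

theorem EbiharaLMI.isBlockLower_stateGain (h : EbiharaLMI A B P J G) :
    IsBlockLower (stateGain J G) := fun i j hij r s => by
  rw [stateGain, Matrix.mul_assoc _ J, flip_kronecker_mul_mul_flip_kronecker]
  exact h.upperJ.mul (h.upperG.inv h.det_ne_zero) _ _ (Fin.rev_lt_rev.2 hij) r s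

end Ebihara

end PTVM

theorem theorem2_general (N n m p : ℕ) (hN : 1 ≤ N)
    (A : Matrix (Fin n) (Fin n) ℝ) (B : Matrix (Fin n) (Fin m) ℝ) (C : Matrix (Fin p) (Fin n) ℝ)
    (Fs : Matrix (Fin N × Fin m) (Fin N × Fin n) ℝ) (hFs : PTVM.IsBlockLower Fs) :
    (∃ (P : Matrix (Fin n) (Fin n) ℝ)
       (V : Matrix ((Fin N × Fin m) ⊕ (Fin (N - 1) × Fin n))
         ((Fin N × Fin m) ⊕ (Fin (N - 1) × Fin n)) ℝ),
       ∃ F ∈ Set.range (PTVM.gainDown (N := N) (m := m) (p := p)),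
         PTVM.BMI A B C P ((PTVM.hMat A B Fs)ᵀ * V) F) ↔
      (PTVM.lyapSet (PTVM.aLTIState A B Fs) ∩ PTVM.lyapSOF N A B C).Nonempty := by
  obtain ⟨K, rfl⟩ : ∃ K, N = K + 1 := ⟨N - 1, (Nat.sub_add_cancel hN).symm⟩
  have hBMI_iff {P : Matrix (Fin n) (Fin n) ℝ} (hP : P.PosDef) F :=
    PTVM.exists_BMI_iff (A := A) (B := B) (C := C) hP (PTVM.isBlockLower_gainDown F) hFs
  constructor
  · rintro ⟨P, V, _, ⟨F, rfl⟩, hV⟩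
    obtain ⟨h_state, h_output⟩ := (hBMI_iff hV.1 F).1 ⟨V, hV⟩
    exact ⟨P, h_state, Set.mem_iUnion₂.2
      ⟨_, ⟨⟨F, rfl⟩, PTVM.spectralRadius_lt_one_of_mem_lyapSet h_output⟩, h_output⟩⟩
  · rintro ⟨P, h_state, h_union⟩
    obtain ⟨_, ⟨⟨F, rfl⟩, -⟩, h_output⟩ := Set.mem_iUnion₂.1 h_union
    obtain ⟨V, hV⟩ := (hBMI_iff h_state.1 F).2 ⟨h_state, h_output⟩
    exact ⟨P, V, _, ⟨F, rfl⟩, hV⟩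

theorem theorem2 (N n m p : ℕ) (hN : 1 ≤ N)
    (A : Matrix (Fin n) (Fin n) ℝ) (B : Matrix (Fin n) (Fin m) ℝ) (C : Matrix (Fin p) (Fin n) ℝ)
    (Phat : Matrix (Fin n) (Fin n) ℝ) (Jhat : Matrix (Fin N × Fin m) (Fin N × Fin n) ℝ)
    (Ghat : Matrix (Fin N × Fin n) (Fin N × Fin n) ℝ)
    (hsol : PTVM.EbiharaLMI A B Phat Jhat Ghat) :
    (∃ (P : Matrix (Fin n) (Fin n) ℝ)
       (V : Matrix ((Fin N × Fin m) ⊕ (Fin (N - 1) × Fin n))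
         ((Fin N × Fin m) ⊕ (Fin (N - 1) × Fin n)) ℝ),
       ∃ F ∈ Set.range (PTVM.gainDown (N := N) (m := m) (p := p)),
         PTVM.BMI A B C P ((PTVM.hMat A B (PTVM.stateGain Jhat Ghat))ᵀ * V) F) ↔
      (PTVM.lyapSet (PTVM.aLTIState A B (PTVM.stateGain Jhat Ghat)) ∩
        PTVM.lyapSOF N A B C).Nonempty :=
  theorem2_general N n m p hN A B C _ hsol.isBlockLower_stateGain
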